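/- Let $d$ be odd and let $\mathcal A=\{H_1,\dots,H_n\}$ be a simple arrangement of $n\ge 1$ affine hyperplanes in $\mathbb R^d$, that is, an indexed family such that, for $0\le k\le d$, any $k$ of the hyperplanes meet in an affine subspace of dimension $d-k$, and any $d+1$ or more of them have empty intersection. For each $i$ let a positive side of $H_i$ (an open halfspace $H_i^+$ bounded by $H_i$) be specified. A tope of $\mathcal A$ is a connected component of $\mathbb R^d\setminus\bigcup_i H_i$; let $\mathcal T(\mathcal A)$ be the set of all topes and $\mathcal T_b(\mathcal A)$ the set of bounded topes. For a set $\mathcal T$ of topes of an arrangement put $$s(\mathcal T)=\sum_{T\in\mathcal T}(-1)^{\sigma(T)},$$ where $\sigma(T)$ is the number of indices $i$ with $T\subseteq H_i^+$ (the signed odd-even invariant of $\mathcal T$). Let $\mathcal A_\infty$ be the central arrangement, indexed in the same way, obtained by translating each $H_i$, together with its positive side, so that it contains the origin. If $n$ is odd, then $s(\mathcal T(\mathcal A))=s(\mathcal T(\mathcal A_\infty))=s(\mathcal T_b(\mathcal A))=0$. If $n$ is even, then $s(\mathcal T_b(\mathcal A))=-\tfrac12\, s(\mathcal T(\mathcal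 A_\infty))$. -/

import Mathlib

/-- An affine hyperplane of `ℝ^d` together with a choice of its positive side: the hyperplane is
`{x | ⟪normal, x⟫ = offset}`, and the nonzero normal vector points to the positive side. -/
structure OrientedHyperplane (d : ℕ) where
  normal : EuclideanSpace ℝ (Fin d)
  normal_ne_zero : normal ≠ 0
  offset : ℝ

namespace OrientedHyperplane

/-- The underlying affine subspace, of dimension `d - 1`. -/
def toAffineSubspace {d : ℕ} (h : OrientedHyperplane d) :
    AffineSubspace ℝ (EuclideanSpace ℝ (Fin d)) where
  carrier := {x | inner ℝ h.normal x = h.offset}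
  smul_vsub_vadd_mem' := by
    intro c p q r hp hq hr
    simp only [Set.mem_ofPred_eq] at hp hq hr ⊢
    simp [inner_add_right, inner_sub_right, inner_smul_right, hp, hq, hr]

/-- The open halfspace on the positive side. -/
def posSide {d : ℕ} (h : OrientedHyperplane d) : Set (EuclideanSpace ℝ (Fin d)) :=
  {x | h.offset < inner ℝ h.normal x}

/-- The translate of an oriented hyperplane that contains the origin (its positive side is
translated along with it). -/
def translateToOrigin {d : ℕ} (h : OrientedHyperplane d) : OrientedHyperplane d where
  normal := h.normal
  normal_ne_zero := h.normal_ne_zero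
  offset := 0

end OrientedHyperplane

/-- An arrangement of `n` hyperplanes in `ℝ^d`: an indexed family of hyperplanes, each with a
specified positive side. Repetitions are allowed. -/
abbrev HyperplaneArrangement (d n : ℕ) : Type := Fin n → OrientedHyperplane d

namespace HyperplaneArrangement

/-- The intersection of the hyperplanes with index in `S` (the whole space if `S` is empty). -/
noncomputable def inter {d n : ℕ} (A : HyperplaneArrangement d n) (S : Finset (Fin n)) :
    AffineSubspace ℝ (EuclideanSpace ℝ (Fin d)) :=
  ⨅ i ∈ S, (A i).toAffineSubspace

/-- An arrangement is simple if, for `0 ≤ k ≤ d`, any `k` of its hyperplanes intersect in a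
(nonempty) affine subspace of dimension `d - k`, and any `d + 1` or more of its hyperplanes have
empty intersection. -/
def IsSimple {d n : ℕ} (A : HyperplaneArrangement d n) : Prop :=
  (∀ S : Finset (Fin n), S.card ≤ d →
    (A.inter S : Set (EuclideanSpace ℝ (Fin d))).Nonempty ∧
      Module.finrank ℝ (A.inter S).direction = d - S.card) ∧
  (∀ S : Finset (Fin n), d + 1 ≤ S.card →
    (A.inter S : Set (EuclideanSpace ℝ (Fin d))) = ∅)

/-- The complement of the union of the hyperplanes. -/
def complement {d n : ℕ} (A : HyperplaneArrangement d n) : Set (EuclideanSpace ℝ (Fin d)) :=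
  (⋃ i, ((A i).toAffineSubspace : Set (EuclideanSpace ℝ (Fin d))))ᶜ

/-- `T` is a tope: a connected component of the complement of the union of the hyperplanes. -/
def IsTope {d n : ℕ} (A : HyperplaneArrangement d n) (T : Set (EuclideanSpace ℝ (Fin d))) :
    Prop :=
  ∃ x ∈ A.complement, T = connectedComponentIn A.complement x

/-- Two points off the hyperplanes with the same set of positive sides lie in the same tope. -/
theorem connectedComponentIn_eq_of_sides {d n : ℕ} (A : HyperplaneArrangement d n)
    {x y : EuclideanSpace ℝ (Fin d)} (hx : x ∈ A.complement) (hy : y ∈ A.complement)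
    (hxy : {i | x ∈ (A i).posSide} = {i | y ∈ (A i).posSide}) :
    connectedComponentIn A.complement x = connectedComponentIn A.complement y := by
  have mem_compl : ∀ z, z ∈ A.complement ↔ ∀ i, inner ℝ (A i).normal z ≠ (A i).offset := by
    intro z
    simp only [complement, Set.mem_compl_iff, Set.mem_iUnion, not_exists]
    exact Iff.rfl
  rw [mem_compl] at hx hy
  have hside : ∀ i, (A i).offset < inner ℝ (A i).normal x ↔
      (A i).offset < inner ℝ (A i).normal y := fun i => Set.ext_iff.mp hxy i
  have hseg : segment ℝ x y ⊆ A.complement := by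
    rintro z ⟨a, b, ha, hb, hab, rfl⟩
    rw [mem_compl]
    intro i
    rw [inner_add_right, inner_smul_right, inner_smul_right]
    obtain rfl : b = 1 - a := by linarith
    rcases lt_or_gt_of_ne (hx i) with h | h
    · have h2 : inner ℝ (A i).normal y < (A i).offset :=
        lt_of_le_of_ne (not_lt.mp fun h3 => absurd ((hside i).mpr h3) (not_lt.mpr h.le)) (hy i)
      apply ne_of_lt
      rcases ha.eq_or_lt with rfl | ha
      · linarith
      · nlinarith [mul_lt_mul_of_pos_left h ha, mul_le_mul_of_nonneg_left h2.le hb]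
    · have h2 := (hside i).mp h
      apply ne_of_gt
      rcases ha.eq_or_lt with rfl | ha
      · linarith
      · nlinarith [mul_lt_mul_of_pos_left h ha, mul_le_mul_of_nonneg_left h2.le hb]
  apply connectedComponentIn_eq
  exact (convex_segment x y).isPreconnected.subset_connectedComponentIn
    (left_mem_segment ℝ x y) hseg (right_mem_segment ℝ x y)

/-- An arrangement has only finitely many topes. -/
theorem finite_setOf_isTope {d n : ℕ} (A : HyperplaneArrangement d n) :
    {T | A.IsTope T}.Finite := by
  classical
  let f : Set (Fin n) → Set (EuclideanSpace ℝ (Fin d)) := fun s =>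
    if h : ∃ x ∈ A.complement, {i | x ∈ (A i).posSide} = s then
      connectedComponentIn A.complement h.choose else ∅
  refine (Set.finite_range f).subset ?_
  rintro T ⟨x, hx, rfl⟩
  have h : ∃ z ∈ A.complement, {i | z ∈ (A i).posSide} = {i | x ∈ (A i).posSide} := ⟨x, hx, rfl⟩
  refine ⟨{i | x ∈ (A i).posSide}, ?_⟩
  simp only [f, dif_pos h]
  exact A.connectedComponentIn_eq_of_sides h.choose_spec.1 hx h.choose_spec.2

/-- The finite set of all topes of the arrangement. -/
noncomputable def topes {d n : ℕ} (A : HyperplaneArrangement d n) :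
    Finset (Set (EuclideanSpace ℝ (Fin d))) :=
  A.finite_setOf_isTope.toFinset

open Classical in
/-- The finite set of all bounded topes of the arrangement. -/
noncomputable def boundedTopes {d n : ℕ} (A : HyperplaneArrangement d n) :
    Finset (Set (EuclideanSpace ℝ (Fin d))) :=
  A.topes.filter fun T => Bornology.IsBounded T

open Classical in
/-- The number of (indices of) hyperplanes on whose positive side `T` lies. -/
noncomputable def sigma {d n : ℕ} (A : HyperplaneArrangement d n)
    (T : Set (EuclideanSpace ℝ (Fin d))) : ℕ :=
  (Finset.univ.filter fun i : Fin n => T ⊆ (A i).posSide).card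

/-- The signed odd-even invariant of a set of topes of the arrangement. -/
noncomputable def signedOddEven {d n : ℕ} (A : HyperplaneArrangement d n)
    (𝒯 : Finset (Set (EuclideanSpace ℝ (Fin d)))) : ℤ :=
  ∑ T ∈ 𝒯, (-1 : ℤ) ^ A.sigma T

/-- The central arrangement of the translates through the origin of the hyperplanes; it is indexed
by the same set and hence may have repeated hyperplanes (when `d = 1`, say). -/
def atInfinity {d n : ℕ} (A : HyperplaneArrangement d n) : HyperplaneArrangement d n :=
  fun i => (A i).translateToOrigin

end HyperplaneArrangement

/-! Encode topes by sign vectors `X`. With normals `a` and offsets `c`, the invariants of `A` and of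
its central arrangement are `(-1)^n` times `F(c) = feasibleSum a c` and `F(0)`.

The core is Euler's relation for one cell (`InGeneralPosition.faceSum_eq`): the alternating face sum
is, up to sign, the feasibility of `X` for `c` minus that for `0`. Multiply by `∏ X i` and sum over
`X`: a proper face lies on some hyperplane `i`, ignores `X i`, and cancels under a flip of that
sign, so only `F(c)` survives (`sum_prod_mul_faceSum`). For odd `d` this reads `F(c) = -(F(c) -
F(0))`, so `2 F(c) = F(0)`; with fewer than `d` hyperplanes all sign vectors are feasible and both
sums vanish.

For odd `n` the antipodal map gives `F(0) = 0`. A nonempty tope is bounded iff its sign vector is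
not realized at infinity (`IsSimple.isBounded_tope_iff`), so the bounded topes contribute `F(c) -
F(0)`, up to `(-1)^n`.

Euler's relation follows by deletion and restriction: both sides obey the same recursion, so their
difference changes sign under every flip, and it vanishes at a sign vector that a linear dependence
of the normals makes infeasible. -/

open Module Filter Topology

/-! ### Sign cells, deletion and restriction -/

section SignCells

variable {ι V : Type*} [NormedAddCommGroup V] [InnerProductSpace ℝ V]

/-- The relatively open cell cut out by the hyperplanes `⟪a i, x⟫ = c i` for `i ∈ W` and by the
open halfspaces with signs `X i` for `i ∈ U`. -/
def signCell (a : ι → V) (c : ι → ℝ) (U W : Finset ι) (X : ι → ℤˣ) : Set V :=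
  {x | (∀ i ∈ W, inner ℝ (a i) x = c i) ∧
    ∀ i ∈ U, 0 < ((X i : ℤ) : ℝ) * (inner ℝ (a i) x - c i)}

open Classical in
/-- The indicator that a cell is nonempty. -/
noncomputable def feasible (a : ι → V) (c : ι → ℝ) (U W : Finset ι) (X : ι → ℤˣ) : ℤ :=
  if (signCell a c U W X).Nonempty then 1 else 0

/-- The hyperplanes `⟪a i, x⟫ = c i` form a simple arrangement. -/
structure InGeneralPosition (a : ι → V) (c : ι → ℝ) : Prop where
  exists_inner_eq : ∀ W : Finset ι, W.card ≤ finrank ℝ V → ∀ y : ι → ℝ,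
    ∃ w, ∀ i ∈ W, inner ℝ (a i) w = y i
  card_le : ∀ (W : Finset ι) (x : V), (∀ i ∈ W, inner ℝ (a i) x = c i) → W.card ≤ finrank ℝ V
  eq_zero : ∀ W : Finset ι, finrank ℝ V ≤ W.card → ∀ v : V,
    (∀ i ∈ W, inner ℝ (a i) v = 0) → v = 0

variable {a : ι → V} {c : ι → ℝ} {U W : Finset ι} {X Y : ι → ℤˣ} {i : ι}

theorem signCell_congr (h : ∀ i ∈ U, X i = Y i) : signCell a c U W X = signCell a c U W Y := by
  ext x
  simp only [signCell, Set.mem_ofPred_eq]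
  refine and_congr_right fun _ => forall₂_congr fun i hi => ?_
  rw [h i hi]

theorem feasible_congr (h : ∀ i ∈ U, X i = Y i) : feasible a c U W X = feasible a c U W Y := by
  rw [feasible, feasible, signCell_congr h]

theorem signUnit_mul_self (u : ℤˣ) : ((u : ℤ) : ℝ) * ((u : ℤ) : ℝ) = 1 := by
  rcases Int.units_eq_one_or u with h | h <;> simp [h]

/-- Strict sign conditions survive a small displacement. -/
theorem eventually_add_smul_mem_signCell {x w : V} (hx : x ∈ signCell a c U W X)
    (hw : ∀ j ∈ W, inner ℝ (a j) w = 0) :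
    ∀ᶠ ε in 𝓝[>] (0 : ℝ), x + ε • w ∈ signCell a c U W X := by
  have h : ∀ᶠ ε in 𝓝[>] (0 : ℝ), ∀ j ∈ U,
      0 < ((X j : ℤ) : ℝ) * (inner ℝ (a j) (x + ε • w) - c j) := by
    rw [Filter.eventually_all_finset]
    intro j hj
    have hc : ContinuousAt (fun ε : ℝ =>
        ((X j : ℤ) : ℝ) * (inner ℝ (a j) (x + ε • w) - c j)) 0 := by fun_prop
    refine nhdsWithin_le_nhds (hc.eventually_const_lt ?_)
    simpa using hx.2 j hj
  filter_upwards [h] with ε hε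
  refine ⟨fun j hj => ?_, hε⟩
  rw [inner_add_right, inner_smul_right, hw j hj, hx.1 j hj, mul_zero, add_zero]

variable [DecidableEq ι]

/-- Reverse the `i`-th sign. -/
def flipSign (i : ι) (X : ι → ℤˣ) : ι → ℤˣ := Function.update X i (-X i)

theorem flipSign_self (i : ι) (X : ι → ℤˣ) : flipSign i X i = -X i := by simp [flipSign]

theorem flipSign_of_ne {j : ι} (h : j ≠ i) (X : ι → ℤˣ) : flipSign i X j = X j := by
  simp [flipSign, h]

theorem flipSign_flipSign (i : ι) (X : ι → ℤˣ) : flipSign i (flipSign i X) = X := by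
  simp [flipSign]

theorem feasible_flipSign (hi : i ∉ U) :
    feasible a c U W (flipSign i X) = feasible a c U W X :=
  feasible_congr fun _ hj => flipSign_of_ne (ne_of_mem_of_not_mem hj hi) X

/-- A cell in the hyperplane `i` is in the boundary of a cell on the prescribed side of it. -/
theorem signCell_insert_nonempty
    (hpert : ∀ x ∈ signCell a c U (insert i W) X,
      ∃ w, (∀ j ∈ W, inner ℝ (a j) w = 0) ∧ inner ℝ (a i) w = 1)
    (h : (signCell a c U (insert i W) X).Nonempty) :
    (signCell a c (insert i U) W X).Nonempty := by
  obtain ⟨x, hx⟩ := h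
  obtain ⟨w, hw, hwi⟩ := hpert x hx
  have hx' : x ∈ signCell a c U W X := ⟨fun j hj => hx.1 j (Finset.mem_insert_of_mem hj), hx.2⟩
  have hev := eventually_add_smul_mem_signCell (w := ((X i : ℤ) : ℝ) • w) hx'
    (fun j hj => by rw [inner_smul_right, hw j hj, mul_zero])
  obtain ⟨ε, hε, hpos⟩ := (hev.and self_mem_nhdsWithin).exists
  refine ⟨_, hε.1, fun j hj => ?_⟩
  rcases Finset.mem_insert.mp hj with rfl | hj
  · rw [inner_add_right, inner_smul_right, inner_smul_right, hwi,
      hx.1 j (Finset.mem_insert_self _ _)]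
    have := signUnit_mul_self (X j)
    have hpos' : 0 < ε := hpos
    calc 0 < ε := hpos'
      _ = ε * (((X j : ℤ) : ℝ) * ((X j : ℤ) : ℝ)) := by rw [this, mul_one]
      _ = _ := by ring
  · exact hε.2 j hj

/-- The hyperplane `i` meets any cell that has points on both of its sides. -/
theorem signCell_nonempty_of_flipSign (hi : i ∉ U)
    (h₁ : (signCell a c (insert i U) W X).Nonempty)
    (h₂ : (signCell a c (insert i U) W (flipSign i X)).Nonempty) :
    (signCell a c U (insert i W) X).Nonempty := by
  obtain ⟨x, hx⟩ := h₁
  obtain ⟨y, hy⟩ := h₂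
  have hp := hx.2 i (Finset.mem_insert_self _ _)
  have hq := hy.2 i (Finset.mem_insert_self _ _)
  rw [flipSign_self, Units.val_neg, Int.cast_neg] at hq
  set p := ((X i : ℤ) : ℝ) * (inner ℝ (a i) x - c i) with hpdef
  set q := -((X i : ℤ) : ℝ) * (inner ℝ (a i) y - c i) with hqdef
  have hpq : 0 < p + q := add_pos hp hq
  -- These weights give the point where the segment from `x` to `y` crosses the hyperplane `i`.
  have key : ∀ j, inner ℝ (a j) ((q / (p + q)) • x + (p / (p + q)) • y) - c j =
      (q / (p + q)) * (inner ℝ (a j) x - c j) + (p / (p + q)) * (inner ℝ (a j) y - c j) := by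
    intro j
    have h1 : q / (p + q) + p / (p + q) = 1 := by field_simp; ring
    rw [inner_add_right, inner_smul_right, inner_smul_right]
    linear_combination (c j) * h1
  refine ⟨(q / (p + q)) • x + (p / (p + q)) • y, fun j hj => ?_, fun j hj => ?_⟩
  · rw [← sub_eq_zero, key]
    rcases Finset.mem_insert.mp hj with rfl | hj
    · have h2 : ((X j : ℤ) : ℝ) * ((q / (p + q)) * (inner ℝ (a j) x - c j) +
          (p / (p + q)) * (inner ℝ (a j) y - c j)) = 0 := by
        have : ((X j : ℤ) : ℝ) * ((q / (p + q)) * (inner ℝ (a j) x - c j) +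
          (p / (p + q)) * (inner ℝ (a j) y - c j)) = (q / (p + q)) * p - (p / (p + q)) * q := by
          rw [hpdef, hqdef]; ring
        rw [this]; ring
      refine (mul_eq_zero.mp h2).resolve_left fun h0 => ?_
      have := signUnit_mul_self (X j)
      simp [h0] at this
    · rw [hx.1 j hj, hy.1 j hj]; ring
  · rw [key, mul_add, mul_left_comm, mul_left_comm _ (p / (p + q))]
    have h3 := hy.2 j (Finset.mem_insert_of_mem hj)
    rw [flipSign_of_ne (ne_of_mem_of_not_mem hj hi)] at h3
    have h4 := hx.2 j (Finset.mem_insert_of_mem hj)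
    positivity

theorem signCell_nonempty_iff (hi : i ∉ U) :
    (signCell a c U W X).Nonempty ↔ (signCell a c (insert i U) W X).Nonempty ∨
      (signCell a c (insert i U) W (flipSign i X)).Nonempty ∨
      (signCell a c U (insert i W) X).Nonempty := by
  constructor
  · rintro ⟨x, hx⟩
    rcases lt_trichotomy 0 (((X i : ℤ) : ℝ) * (inner ℝ (a i) x - c i)) with h | h | h
    · refine Or.inl ⟨x, hx.1, fun j hj => ?_⟩
      rcases Finset.mem_insert.mp hj with rfl | hj
      exacts [h, hx.2 j hj]
    · refine Or.inr (Or.inr ⟨x, fun j hj => ?_, hx.2⟩)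
      rcases Finset.mem_insert.mp hj with rfl | hj
      · rcases mul_eq_zero.mp h.symm with h0 | h0
        · have := signUnit_mul_self (X j)
          simp [h0] at this
        · linarith
      · exact hx.1 j hj
    · refine Or.inr (Or.inl ⟨x, hx.1, fun j hj => ?_⟩)
      rcases Finset.mem_insert.mp hj with rfl | hj
      · rw [flipSign_self, Units.val_neg, Int.cast_neg]
        linarith
      · rw [flipSign_of_ne (ne_of_mem_of_not_mem hj hi)]
        exact hx.2 j hj
  · rintro (⟨x, hx⟩ | ⟨x, hx⟩ | ⟨x, hx⟩)
    · exact ⟨x, hx.1, fun j hj => hx.2 j (Finset.mem_insert_of_mem hj)⟩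
    · refine ⟨x, hx.1, fun j hj => ?_⟩
      have := hx.2 j (Finset.mem_insert_of_mem hj)
      rwa [flipSign_of_ne (ne_of_mem_of_not_mem hj hi)] at this
    · exact ⟨x, fun j hj => hx.1 j (Finset.mem_insert_of_mem hj), hx.2⟩

/-- Deletion and restriction for feasibility of sign vectors. -/
theorem feasible_insert_add_flipSign (hi : i ∉ U)
    (hpert : ∀ x ∈ signCell a c U (insert i W) X,
      ∃ w, (∀ j ∈ W, inner ℝ (a j) w = 0) ∧ inner ℝ (a i) w = 1) :
    feasible a c (insert i U) W X + feasible a c (insert i U) W (flipSign i X) =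
      feasible a c U W X + feasible a c U (insert i W) X := by
  have h1 := signCell_nonempty_iff (a := a) (c := c) (W := W) (X := X) hi
  have h2 := signCell_nonempty_of_flipSign (a := a) (c := c) (W := W) (X := X) hi
  have h3 := signCell_insert_nonempty hpert
  have hX : signCell a c U (insert i W) (flipSign i X) = signCell a c U (insert i W) X :=
    signCell_congr fun _ hj => flipSign_of_ne (ne_of_mem_of_not_mem hj hi) X
  -- A cell inside the hyperplane `i` ignores `X i`, so it borders both halves: either the
  -- hyperplane cuts the cell and both halves are nonempty, or at most one is.
  have h4 := signCell_insert_nonempty (X := flipSign i X) (by rwa [hX])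
  rw [hX] at h4
  unfold feasible
  by_cases p : (signCell a c (insert i U) W X).Nonempty <;>
  by_cases q : (signCell a c (insert i U) W (flipSign i X)).Nonempty <;>
  by_cases r : (signCell a c U (insert i W) X).Nonempty <;>
  by_cases s : (signCell a c U W X).Nonempty <;> simp [p, q, r, s] at h1 h2 h3 h4 ⊢

/-- The alternating sum of the feasibility indicators of the faces of a cell. -/
noncomputable def faceSum (a : ι → V) (c : ι → ℝ) (U W : Finset ι) (X : ι → ℤˣ) : ℤ :=
  ∑ Z ∈ U.powerset, (-1) ^ Z.card * feasible a c (U \ Z) (W ∪ Z) X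

theorem InGeneralPosition.exists_pert (hG : InGeneralPosition a c) (hi : i ∉ W)
    (h : (insert i W).card ≤ finrank ℝ V) :
    ∃ w, (∀ j ∈ W, inner ℝ (a j) w = 0) ∧ inner ℝ (a i) w = 1 := by
  obtain ⟨w, hw⟩ := hG.exists_inner_eq (insert i W) h (fun j => if j = i then 1 else 0)
  refine ⟨w, fun j hj => ?_, ?_⟩
  · rw [hw j (Finset.mem_insert_of_mem hj), if_neg (ne_of_mem_of_not_mem hj hi)]
  · rw [hw i (Finset.mem_insert_self _ _), if_pos rfl]

/-- Faces off the hyperplane `i` give deletion plus restriction; faces in it are counted once for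
each sign of `i`, giving minus twice the restriction. -/
theorem InGeneralPosition.faceSum_insert_add_flipSign (hG : InGeneralPosition a c)
    (hi : i ∉ U) (hiW : i ∉ W) :
    faceSum a c (insert i U) W X + faceSum a c (insert i U) W (flipSign i X) =
      faceSum a c U W X - faceSum a c U (insert i W) X := by
  unfold faceSum
  rw [Finset.sum_powerset_insert hi, Finset.sum_powerset_insert hi, ← Finset.sum_add_distrib,
    ← Finset.sum_add_distrib, ← Finset.sum_add_distrib, ← Finset.sum_sub_distrib]
  refine Finset.sum_congr rfl fun Z hZ => ?_
  have hiZ : i ∉ Z := fun h => hi (Finset.mem_powerset.mp hZ h)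
  have hiU : i ∉ U \ Z := fun h => hi (Finset.mem_sdiff.mp h).1
  have hiWZ : i ∉ W ∪ Z := by simp [hiW, hiZ]
  have e1 : insert i U \ Z = insert i (U \ Z) := Finset.insert_sdiff_of_notMem _ hiZ
  have e2 : insert i U \ insert i Z = U \ Z := by
    ext j
    by_cases hj : j = i
    · subst hj; simp [hi]
    · simp [hj]
  have e3 : W ∪ insert i Z = insert i (W ∪ Z) := Finset.union_insert _ _ _
  have e4 : insert i W ∪ Z = insert i (W ∪ Z) := Finset.insert_union _ _ _
  rw [e1, e2, e3, e4, feasible_flipSign hiU, Finset.card_insert_of_notMem hiZ, pow_succ]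
  have key := feasible_insert_add_flipSign (a := a) (c := c) (W := W ∪ Z) (X := X) hiU
    fun x hx => hG.exists_pert hiWZ (hG.card_le _ x hx.1)
  linear_combination (-1) ^ Z.card * key

end SignCells

/-! ### Euler's relation -/

section FaceSum

variable {ι V : Type*} [DecidableEq ι] [NormedAddCommGroup V] [InnerProductSpace ℝ V]
variable {a : ι → V} {c : ι → ℝ} {U W : Finset ι} {X Y : ι → ℤˣ} {i : ι}

theorem faceSum_congr (h : ∀ i ∈ U, X i = Y i) : faceSum a c U W X = faceSum a c U W Y :=
  Finset.sum_congr rfl fun Z _ => by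
    rw [feasible_congr fun i hi => h i (Finset.mem_sdiff.mp hi).1]

/-- So few normals are independent, and their inner products with a point can be prescribed.
Independence does not involve the offsets, so `c'` is free; `c` and `0` are both needed. -/
theorem InGeneralPosition.signCell_nonempty_of_card_le (hG : InGeneralPosition a c)
    (hUW : Disjoint U W) (h : U.card + W.card ≤ finrank ℝ V) (c' : ι → ℝ) :
    (signCell a c' U W X).Nonempty := by
  rw [← Finset.card_union_of_disjoint hUW] at h
  obtain ⟨w, hw⟩ := hG.exists_inner_eq (U ∪ W) h
    (fun j => if j ∈ W then c' j else c' j + ((X j : ℤ) : ℝ))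
  refine ⟨w, fun j hj => ?_, fun j hj => ?_⟩
  · rw [hw j (Finset.mem_union_right _ hj), if_pos hj]
  · rw [hw j (Finset.mem_union_left _ hj), if_neg (Finset.disjoint_left.mp hUW hj),
      add_sub_cancel_left, signUnit_mul_self]
    exact one_pos

/-- A nonempty face of a cell witnesses that the cell is nonempty. -/
theorem InGeneralPosition.signCell_nonempty_of_face (hG : InGeneralPosition a c)
    (hUW : Disjoint U W) (Z : Finset ι) (hZ : Z ⊆ U)
    (h : (signCell a c (U \ Z) (W ∪ Z) X).Nonempty) : (signCell a c U W X).Nonempty := by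
  induction Z using Finset.induction_on with
  | empty => simpa using h
  | insert i Z hiZ ih =>
    have hiU : i ∈ U := hZ (Finset.mem_insert_self _ _)
    refine ih (fun j hj => hZ (Finset.mem_insert_of_mem hj)) ?_
    rw [Finset.union_insert] at h
    have e : U \ Z = insert i (U \ insert i Z) := by
      ext j
      by_cases hj : j = i
      · subst hj; simp [hiU, hiZ]
      · simp [hj]
    have hiWZ : i ∉ W ∪ Z := by simp [Finset.disjoint_left.mp hUW hiU, hiZ]
    rw [e]
    exact signCell_insert_nonempty
      (fun x hx => hG.exists_pert hiWZ (hG.card_le _ x hx.1)) h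

theorem InGeneralPosition.faceSum_eq_zero (hG : InGeneralPosition a c)
    (hUW : Disjoint U W) (h : ¬ (signCell a c U W X).Nonempty) : faceSum a c U W X = 0 :=
  Finset.sum_eq_zero fun Z hZ => by
    rw [feasible, if_neg fun hne =>
      h (hG.signCell_nonempty_of_face hUW Z (Finset.mem_powerset.mp hZ) hne), mul_zero]

/-- No point lies on more than `finrank ℝ V` hyperplanes, so the cell has no proper faces. -/
theorem InGeneralPosition.faceSum_of_le_card (hG : InGeneralPosition a c)
    (hUW : Disjoint U W) (hW : finrank ℝ V ≤ W.card) :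
    faceSum a c U W X = feasible a c U W X := by
  unfold faceSum
  rw [Finset.sum_eq_single ∅]
  · simp
  · intro Z hZ hZ0
    rw [feasible, if_neg, mul_zero]
    rintro ⟨x, hx⟩
    have h1 := hG.card_le _ x hx.1
    rw [Finset.card_union_of_disjoint
      (hUW.symm.mono_right (Finset.mem_powerset.mp hZ))] at h1
    have := Finset.card_pos.mpr (Finset.nonempty_iff_ne_empty.mpr hZ0)
    omega
  · simp

/-- All faces are nonempty, leaving the alternating sum over the subsets of `U`. -/
theorem InGeneralPosition.faceSum_of_card_le (hG : InGeneralPosition a c)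
    (hUW : Disjoint U W) (hU : U.Nonempty) (h : U.card + W.card ≤ finrank ℝ V) :
    faceSum a c U W X = 0 := by
  have : faceSum a c U W X = ∑ Z ∈ U.powerset, (-1 : ℤ) ^ Z.card := by
    refine Finset.sum_congr rfl fun Z hZ => ?_
    have hZ := Finset.mem_powerset.mp hZ
    have hc := Finset.card_sdiff_add_card_eq_card hZ
    rw [feasible, if_pos (hG.signCell_nonempty_of_card_le ?_ ?_ c), mul_one]
    · rw [Finset.disjoint_union_right]
      exact ⟨hUW.mono_left Finset.sdiff_subset, Finset.sdiff_disjoint⟩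
    · have := Finset.card_union_le W Z
      omega
  rw [this, Finset.sum_powerset_neg_one_pow_card_of_nonempty hU]

/-- The easy half of Farkas' lemma: at a point of the cell the terms `l j * (⟪a j, x⟫ - c j)` are
nonnegative, the `i`-th one positive, yet the dependence makes their sum `-∑ l j * c j ≤ 0`. -/
theorem signCell_not_nonempty_of_dependent {l : ι → ℝ} {S : Finset ι}
    (hl : ∑ j ∈ S, l j • a j = 0) (hS : S ⊆ U ∪ W) (hi : i ∈ S) (hiW : i ∉ W) (hli : l i ≠ 0)
    (hX : ∀ j ∈ S, 0 ≤ ((X j : ℤ) : ℝ) * l j) (hc : 0 ≤ ∑ j ∈ S, l j * c j) :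
    ¬ (signCell a c U W X).Nonempty := by
  rintro ⟨x, hx⟩
  have h0 : ∑ j ∈ S, l j * (inner ℝ (a j) x - c j) = - ∑ j ∈ S, l j * c j := by
    have := congrArg (fun v => inner ℝ v x) hl
    simp only [sum_inner, inner_smul_left, inner_zero_left, RCLike.conj_to_real] at this
    simp only [mul_sub, Finset.sum_sub_distrib, this, zero_sub]
  have e : ∀ j, l j * (inner ℝ (a j) x - c j) =
      (((X j : ℤ) : ℝ) * l j) * (((X j : ℤ) : ℝ) * (inner ℝ (a j) x - c j)) := fun j => by
    linear_combination (-(l j * (inner ℝ (a j) x - c j))) * signUnit_mul_self (X j)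
  have hpos : 0 < ∑ j ∈ S, l j * (inner ℝ (a j) x - c j) := by
    refine Finset.sum_pos' (fun j hj => ?_) ⟨i, hi, ?_⟩
    · by_cases hjW : j ∈ W
      · rw [hx.1 j hjW, sub_self, mul_zero]
      · rw [e]
        exact mul_nonneg (hX j hj)
          (hx.2 j ((Finset.mem_union.mp (hS hj)).resolve_right hjW)).le
    · rw [e]
      refine mul_pos (lt_of_le_of_ne (hX i hi) (Ne.symm ?_))
        (hx.2 i ((Finset.mem_union.mp (hS hi)).resolve_right hiW))
      refine mul_ne_zero (fun h => ?_) hli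
      have := signUnit_mul_self (X i)
      simp [h] at this
  linarith

/-- More than `finrank ℝ V` hyperplanes do not realize all sign vectors. -/
theorem InGeneralPosition.exists_infeasible [FiniteDimensional ℝ V] (hG : InGeneralPosition a c)
    (hUW : Disjoint U W) (hW : W.card ≤ finrank ℝ V) (h : finrank ℝ V < U.card + W.card) :
    ∃ X : ι → ℤˣ, ¬ (signCell a c U W X).Nonempty ∧ ¬ (signCell a 0 U W X).Nonempty := by
  have hdep : ¬ LinearIndepOn ℝ a (U ∪ W : Finset ι) := fun hli => by
    have := LinearIndependent.fintype_card_le_finrank hli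
    simp only [Finset.coe_sort_coe, Fintype.card_coe, Finset.card_union_of_disjoint hUW] at this
    omega
  have hex : ∃ l : ι → ℝ, ∑ j ∈ U ∪ W, l j • a j = 0 ∧ ∃ j ∈ U ∪ W, l j ≠ 0 := by
    rw [linearIndepOn_finset_iff] at hdep
    push Not at hdep
    exact hdep
  obtain ⟨l, hl, k, hk, hlk⟩ := hex
  -- A dependence supported on `W` is paired with some `w` such that `⟪a j, w⟫ = l j` on `W`; then
  -- `∑ l j * l j = 0`.
  have hU : ∃ i ∈ U, l i ≠ 0 := by
    by_contra! hcon
    obtain ⟨w, hw⟩ := hG.exists_inner_eq W hW l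
    have h1 := congrArg (fun v => inner ℝ v w) hl
    simp only [sum_inner, inner_smul_left, inner_zero_left, RCLike.conj_to_real] at h1
    rw [Finset.sum_union hUW, Finset.sum_eq_zero (fun j hj => by rw [hcon j hj, zero_mul]),
      zero_add, Finset.sum_congr rfl (fun j hj => by rw [hw j hj]),
      Finset.sum_eq_zero_iff_of_nonneg (fun j _ => mul_self_nonneg _)] at h1
    rcases Finset.mem_union.mp hk with hk | hk
    · exact hlk (hcon k hk)
    · exact hlk (mul_self_eq_zero.mp (h1 k hk))
  obtain ⟨i, hi, hli⟩ := hU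
  have main : ∀ m : ι → ℝ, ∑ j ∈ U ∪ W, m j • a j = 0 → m i ≠ 0 →
      0 ≤ ∑ j ∈ U ∪ W, m j * c j →
      ∃ X : ι → ℤˣ, ¬ (signCell a c U W X).Nonempty ∧ ¬ (signCell a 0 U W X).Nonempty := by
    intro m hm hmi hc
    have hX : ∀ j ∈ U ∪ W, 0 ≤ (((if 0 ≤ m j then 1 else -1 : ℤˣ) : ℤ) : ℝ) * m j := by
      intro j _
      split_ifs with h0
      · simpa using h0
      · simpa using (not_le.mp h0).le
    have hi' := Finset.mem_union_left W hi
    have hiW := Finset.disjoint_left.mp hUW hi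
    exact ⟨fun j => if 0 ≤ m j then 1 else -1,
      signCell_not_nonempty_of_dependent hm subset_rfl hi' hiW hmi hX hc,
      signCell_not_nonempty_of_dependent hm subset_rfl hi' hiW hmi hX (by simp)⟩
  -- One of `l`, `-l` pairs nonnegatively with `c`; for offsets `0` the pairing is zero, so one sign
  -- vector serves both.
  rcases le_total 0 (∑ j ∈ U ∪ W, l j * c j) with h0 | h0
  · exact main l hl hli h0
  · refine main (fun j => -l j) ?_ (neg_ne_zero.mpr hli) ?_
    · simp only [neg_smul, Finset.sum_neg_distrib, hl, neg_zero]
    · simp only [neg_mul, Finset.sum_neg_distrib]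
      linarith

/-- A function of sign vectors on `U` that vanishes somewhere and changes its sign under flips is
zero. -/
theorem eq_zero_of_flipSign {f : (ι → ℤˣ) → ℤ} (hf : ∀ X Y, (∀ j ∈ U, X j = Y j) → f X = f Y)
    (hflip : ∀ i ∈ U, ∀ X, f X + f (flipSign i X) = 0) (hY : f Y = 0) (X : ι → ℤˣ) :
    f X = 0 := by
  -- `T` collects the indices at which `X` may differ from `Y`; they are flipped one at a time.
  suffices h : ∀ T ⊆ U, ∀ X : ι → ℤˣ, (∀ j ∈ U, j ∉ T → X j = Y j) → f X = 0 from
    h U subset_rfl X fun j hj hj' => absurd hj hj'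
  intro T
  induction T using Finset.induction_on with
  | empty => exact fun _ X hX => (hf X Y fun j hj => hX j hj (by simp)).trans hY
  | insert i T hiT ih =>
    intro hT X hX
    have hT' : T ⊆ U := fun j hj => hT (Finset.mem_insert_of_mem hj)
    by_cases hi : X i = Y i
    · refine ih hT' X fun j hj hjT => ?_
      by_cases hji : j = i
      · rwa [hji]
      · exact hX j hj (by simp [hji, hjT])
    · have h1 := hflip i (hT (Finset.mem_insert_self _ _)) X
      rw [ih hT' (flipSign i X) fun j hj hjT => ?_, add_zero] at h1
      · exact h1
      · by_cases hji : j = i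
        · rw [hji, flipSign_self, Int.units_ne_iff_eq_neg.mp hi, neg_neg]
        · rw [flipSign_of_ne hji]
          exact hX j hj (by simp [hji, hjT])

/-- **Euler's relation** for the cells of a simple arrangement: the alternating sum over the faces
of a cell detects whether the cell is nonempty and has no interior direction of recession. -/
theorem InGeneralPosition.faceSum_eq [FiniteDimensional ℝ V] (hG : InGeneralPosition a c)
    (hUW : Disjoint U W) (hU : U.Nonempty) (h : finrank ℝ V ≤ U.card + W.card) (X : ι → ℤˣ) :
    faceSum a c U W X =
      (-1) ^ (finrank ℝ V + W.card) * (feasible a c U W X - feasible a 0 U W X) := by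
  induction hn : U.card generalizing U W X with
  | zero => exact absurd (Finset.card_pos.mpr hU) (by omega)
  | succ n ih =>
    by_cases hW : finrank ℝ V ≤ W.card
    · have h0 : feasible a 0 U W X = 0 := by
        rw [feasible, if_neg]
        rintro ⟨v, hv⟩
        obtain ⟨i, hi⟩ := hU
        have := hv.2 i hi
        rw [hG.eq_zero W hW v hv.1] at this
        simp at this
      rw [hG.faceSum_of_le_card hUW hW, h0, sub_zero]
      by_cases hW' : W.card = finrank ℝ V
      · rw [hW', Even.neg_one_pow ⟨_, rfl⟩, one_mul]
      · rw [feasible, if_neg, mul_zero]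
        rintro ⟨x, hx⟩
        have := hG.card_le W x hx.1
        omega
    · by_cases hle : U.card + W.card ≤ finrank ℝ V
      · rw [hG.faceSum_of_card_le hUW hU hle, feasible, feasible,
          if_pos (hG.signCell_nonempty_of_card_le hUW hle c),
          if_pos (hG.signCell_nonempty_of_card_le hUW hle 0), sub_self, mul_zero]
      · obtain ⟨Y, hY, hY0⟩ := hG.exists_infeasible hUW (by omega) (by omega)
        refine sub_eq_zero.mp (eq_zero_of_flipSign (U := U) (Y := Y)
          (f := fun X => faceSum a c U W X -
            (-1) ^ (finrank ℝ V + W.card) * (feasible a c U W X - feasible a 0 U W X)) ?_ ?_ ?_ X)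
        · intro X X' hX
          simp only [faceSum_congr hX, feasible_congr hX]
        · intro i hi X
          have hiW := Finset.disjoint_left.mp hUW hi
          obtain ⟨U', hiU', rfl⟩ : ∃ U', i ∉ U' ∧ insert i U' = U :=
            ⟨U.erase i, Finset.notMem_erase _ _, Finset.insert_erase hi⟩
          rw [Finset.card_insert_of_notMem hiU'] at hn h hle
          have hUW' : Disjoint U' W := hUW.mono_left (Finset.subset_insert _ _)
          have hcW : (insert i W).card = W.card + 1 := Finset.card_insert_of_notMem hiW
          -- `W.card < finrank ℝ V < U.card + W.card` forces `U` to have at least two elements.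
          have hne : U'.Nonempty := Finset.card_pos.mp (by omega)
          have r1 := ih hUW' hne (by omega) X (by omega)
          have r2 := ih (W := insert i W)
            (Finset.disjoint_insert_right.mpr ⟨hiU', hUW'⟩) hne (by omega) X (by omega)
          have r3 := hG.faceSum_insert_add_flipSign (X := X) hiU' hiW
          have r4 := feasible_insert_add_flipSign (a := a) (c := c) (W := W) (X := X) hiU'
            fun x hx => hG.exists_pert hiW (hG.card_le _ x hx.1)
          -- All central hyperplanes meet at the origin, so here the room to perturb comes from
          -- `W.card < finrank ℝ V` instead of from `card_le`.
          have r5 := feasible_insert_add_flipSign (a := a) (c := 0) (W := W) (X := X) hiU'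
            fun x _ => hG.exists_pert hiW (by omega)
          rw [hcW, ← add_assoc, pow_succ] at r2
          linear_combination r3 + r1 - r2 - (-1) ^ (finrank ℝ V + W.card) * (r4 - r5)
        · rw [hG.faceSum_eq_zero hUW hY, feasible, feasible, if_neg hY, if_neg hY0]
          simp

/-! ### Signed sums over sign vectors -/

/-- The signed sum over all sign vectors of the feasible ones. -/
noncomputable def feasibleSum [Fintype ι] (a : ι → V) (c : ι → ℝ) : ℤ :=
  ∑ X : ι → ℤˣ, (∏ i, (X i : ℤ)) * feasible a c Finset.univ ∅ X

theorem prod_flipSign [Fintype ι] (i : ι) (X : ι → ℤˣ) :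
    ∏ j, (flipSign i X j : ℤ) = -∏ j, (X j : ℤ) := by
  rw [← Finset.mul_prod_erase _ _ (Finset.mem_univ i),
    ← Finset.mul_prod_erase _ (fun j => (X j : ℤ)) (Finset.mem_univ i), flipSign_self,
    Finset.prod_congr rfl fun j hj => by rw [flipSign_of_ne (Finset.ne_of_mem_erase hj)]]
  push_cast
  ring

/-- `flipSign i` is a sign-reversing involution. -/
theorem sum_prod_mul_eq_zero [Fintype ι] (i : ι) {f : (ι → ℤˣ) → ℤ}
    (hf : ∀ X, f (flipSign i X) = f X) : ∑ X : ι → ℤˣ, (∏ j, (X j : ℤ)) * f X = 0 := by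
  have h : ∑ X : ι → ℤˣ, (∏ j, (flipSign i X j : ℤ)) * f (flipSign i X) =
      ∑ X : ι → ℤˣ, (∏ j, (X j : ℤ)) * f X := Equiv.sum_comp (Function.Involutive.toPerm (flipSign (ι := ι) i) (flipSign_flipSign i))
    (fun X => (∏ j, (X j : ℤ)) * f X)
  simp only [prod_flipSign, hf, neg_mul,
    Finset.sum_neg_distrib] at h
  omega

theorem sum_prod_mul_faceSum [Fintype ι] :
    ∑ X : ι → ℤˣ, (∏ j, (X j : ℤ)) * faceSum a c Finset.univ ∅ X = feasibleSum a c := by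
  simp only [faceSum, feasibleSum, Finset.mul_sum]
  rw [Finset.sum_comm, Finset.sum_eq_single ∅]
  · simp
  · intro Z _ hZ
    obtain ⟨i, hi⟩ := Finset.nonempty_iff_ne_empty.mpr hZ
    exact sum_prod_mul_eq_zero i fun X => by rw [feasible_flipSign (by simp [hi])]
  · simp

theorem InGeneralPosition.two_mul_feasibleSum [Fintype ι] [Nonempty ι] [FiniteDimensional ℝ V]
    (hG : InGeneralPosition a c) (hd : Odd (finrank ℝ V)) :
    2 * feasibleSum a c = feasibleSum a 0 := by
  obtain ⟨i⟩ := ‹Nonempty ι›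
  by_cases h : finrank ℝ V ≤ Fintype.card ι
  · have h1 := sum_prod_mul_faceSum (a := a) (c := c)
    have h2 : ∀ X, faceSum a c Finset.univ ∅ X =
        -(feasible a c Finset.univ ∅ X - feasible a 0 Finset.univ ∅ X) := fun X => by
      rw [hG.faceSum_eq (Finset.disjoint_empty_right _) ⟨i, Finset.mem_univ i⟩ (by simpa using h),
        Finset.card_empty, add_zero, hd.neg_one_pow, neg_one_mul]
    simp only [h2, mul_neg, mul_sub, Finset.sum_neg_distrib, Finset.sum_sub_distrib] at h1
    change -(feasibleSum a c - feasibleSum a 0) = _ at h1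
    omega
  · have h3 : ∀ c', feasibleSum a c' = 0 := fun c' =>
      sum_prod_mul_eq_zero i fun X => by
        simp only [feasible]
        rw [if_pos, if_pos] <;>
        exact hG.signCell_nonempty_of_card_le (Finset.disjoint_empty_right _)
          (by simpa using (not_le.mp h).le) c'
    rw [h3, h3, mul_zero]

/-- The antipodal map on a central arrangement. -/
theorem feasibleSum_zero_of_odd [Fintype ι] (h : Odd (Fintype.card ι)) :
    feasibleSum a 0 = 0 := by
  have hf : ∀ X : ι → ℤˣ, (signCell a 0 Finset.univ ∅ X).Nonempty →
      (signCell a 0 Finset.univ ∅ (-X)).Nonempty := by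
    rintro X ⟨x, hx⟩
    refine ⟨-x, by simp, fun i hi => ?_⟩
    have := hx.2 i hi
    simpa using this
  have h1 : ∀ X, feasible a 0 Finset.univ ∅ (-X) = feasible a 0 Finset.univ ∅ X := fun X => by
    have : (signCell a 0 Finset.univ ∅ (-X)).Nonempty ↔
        (signCell a 0 Finset.univ ∅ X).Nonempty := ⟨fun h => by simpa using hf _ h, hf X⟩
    unfold feasible
    split_ifs <;> tauto
  have h2 := Equiv.sum_comp (Equiv.neg (ι → ℤˣ))
    (fun X => (∏ i, (X i : ℤ)) * feasible a 0 Finset.univ ∅ X)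
  simp only [Equiv.neg_apply, h1, Pi.neg_apply, Units.val_neg, Finset.prod_neg, Finset.card_univ,
    h.neg_one_pow, neg_mul, one_mul,
    Finset.sum_neg_distrib] at h2
  change -feasibleSum a 0 = feasibleSum a 0 at h2
  omega

end FaceSum

/-! ### Topes as sign cells -/

namespace HyperplaneArrangement

variable {d n : ℕ} (A : HyperplaneArrangement d n)

/-- The tope with the prescribed signs (empty if there is none). -/
def tope (X : Fin n → ℤˣ) : Set (EuclideanSpace ℝ (Fin d)) :=
  signCell (fun i => (A i).normal) (fun i => (A i).offset) Finset.univ ∅ X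

theorem mem_tope {X : Fin n → ℤˣ} {x : EuclideanSpace ℝ (Fin d)} : x ∈ A.tope X ↔
    ∀ i, 0 < ((X i : ℤ) : ℝ) * (inner ℝ (A i).normal x - (A i).offset) := by
  simp [tope, signCell]

theorem mem_complement {x : EuclideanSpace ℝ (Fin d)} :
    x ∈ A.complement ↔ ∀ i, inner ℝ (A i).normal x ≠ (A i).offset := by
  simp only [complement, Set.mem_compl_iff, Set.mem_iUnion, not_exists]
  exact Iff.rfl

variable {A}

theorem tope_subset_complement (X : Fin n → ℤˣ) : A.tope X ⊆ A.complement := by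
  intro x hx
  rw [mem_tope] at hx
  rw [mem_complement]
  intro i hi
  have := hx i
  simp [hi] at this

theorem mem_posSide_iff {X : Fin n → ℤˣ} {x : EuclideanSpace ℝ (Fin d)} (hx : x ∈ A.tope X)
    (i : Fin n) : x ∈ (A i).posSide ↔ X i = 1 := by
  have h := A.mem_tope.mp hx i
  change (A i).offset < inner ℝ (A i).normal x ↔ _
  rcases Int.units_eq_one_or (X i) with hi | hi
  · simp only [hi, iff_true]
    simp [hi] at h
    exact h
  · simp only [hi, Units.val_neg, Units.val_one, Int.cast_neg, Int.cast_one, neg_one_mul] at h ⊢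
    refine ⟨fun h' => by linarith, fun h' => absurd h' (by decide)⟩

theorem exists_mem_tope {x : EuclideanSpace ℝ (Fin d)} (hx : x ∈ A.complement) :
    ∃ X, x ∈ A.tope X := by
  rw [mem_complement] at hx
  refine ⟨fun i => if (A i).offset < inner ℝ (A i).normal x then 1 else -1, A.mem_tope.mpr ?_⟩
  intro i
  split_ifs with h
  · simpa using h
  · simpa using lt_of_le_of_ne (not_lt.mp h) (hx i)

theorem eq_of_mem_tope {X Y : Fin n → ℤˣ} {x : EuclideanSpace ℝ (Fin d)} (hX : x ∈ A.tope X)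
    (hY : x ∈ A.tope Y) : X = Y := by
  funext i
  have h : X i = 1 ↔ Y i = 1 := (mem_posSide_iff hX i).symm.trans (mem_posSide_iff hY i)
  rcases Int.units_eq_one_or (X i) with h1 | h1 <;> rcases Int.units_eq_one_or (Y i) with h2 | h2 <;>
    simp_all

/-- On the component the continuous functions `X i * (⟪a i, z⟫ - c i)` have no zero, hence keep
their sign. -/
theorem connectedComponentIn_complement {X : Fin n → ℤˣ} {x : EuclideanSpace ℝ (Fin d)}
    (hx : x ∈ A.tope X) : connectedComponentIn A.complement x = A.tope X := by
  have hxc := tope_subset_complement X hx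
  apply subset_antisymm
  · intro y hy
    rw [mem_tope]
    intro i
    by_contra hcon
    have hpre := (isPreconnected_connectedComponentIn (F := A.complement) (x := x)).image
      (fun z => ((X i : ℤ) : ℝ) * (inner ℝ (A i).normal z - (A i).offset))
      (by fun_prop)
    have h0 := hpre.ordConnected.out (Set.mem_image_of_mem _ hy)
      (Set.mem_image_of_mem _ (mem_connectedComponentIn hxc))
      ⟨not_lt.mp hcon, (A.mem_tope.mp hx i).le⟩
    obtain ⟨z, hz, hz0⟩ := h0
    have hzc := A.mem_complement.mp (connectedComponentIn_subset _ _ hz) i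
    rcases mul_eq_zero.mp hz0 with h | h
    · simp at h
    · exact hzc (sub_eq_zero.mp h)
  · intro y hy
    have hyc := tope_subset_complement X hy
    rw [A.connectedComponentIn_eq_of_sides hxc hyc]
    · exact mem_connectedComponentIn hyc
    · ext i
      exact (mem_posSide_iff hx i).trans (mem_posSide_iff hy i).symm

open Classical in
theorem topes_eq_image :
    A.topes = (Finset.univ.filter fun X => (A.tope X).Nonempty).image A.tope := by
  ext T
  simp only [topes, Set.Finite.mem_toFinset, Set.mem_ofPred_eq, Finset.mem_image,
    Finset.mem_filter, Finset.mem_univ, true_and]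
  constructor
  · rintro ⟨x, hx, rfl⟩
    obtain ⟨X, hX⟩ := exists_mem_tope hx
    exact ⟨X, ⟨x, hX⟩, (connectedComponentIn_complement hX).symm⟩
  · rintro ⟨X, ⟨x, hx⟩, rfl⟩
    exact ⟨x, tope_subset_complement X hx, (connectedComponentIn_complement hx).symm⟩

/-- `sigma` counts the signs `1`, whereas `∏ X i` has the parity of the signs `-1`; this accounts
for `(-1) ^ n`. -/
theorem neg_one_pow_sigma_tope {X : Fin n → ℤˣ} (h : (A.tope X).Nonempty) :
    (-1 : ℤ) ^ A.sigma (A.tope X) = (-1) ^ n * ∏ i, (X i : ℤ) := by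
  obtain ⟨x, hx⟩ := h
  have hi : ∀ i, A.tope X ⊆ (A i).posSide ↔ X i = 1 := fun i =>
    ⟨fun h => (mem_posSide_iff hx i).mp (h hx), fun h y hy => (mem_posSide_iff hy i).mpr h⟩
  have e : (-1 : ℤ) ^ n = ∏ _i : Fin n, (-1 : ℤ) := by simp
  rw [sigma, ← Finset.prod_const, Finset.prod_filter, e, ← Finset.prod_mul_distrib]
  refine Finset.prod_congr rfl fun i _ => ?_
  simp only [hi]
  rcases Int.units_eq_one_or (X i) with h | h <;> simp [h]

open Classical in
theorem sum_filter_topes (p : Set (EuclideanSpace ℝ (Fin d)) → Prop) :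
    A.signedOddEven (A.topes.filter p) =
      (-1) ^ n * ∑ X : Fin n → ℤˣ, (∏ i, (X i : ℤ)) *
        if (A.tope X).Nonempty ∧ p (A.tope X) then 1 else 0 := by
  rw [signedOddEven, topes_eq_image, Finset.filter_image, Finset.sum_image, Finset.filter_filter,
    Finset.sum_filter, Finset.mul_sum]
  · refine Finset.sum_congr rfl fun X _ => ?_
    split_ifs with h
    · rw [neg_one_pow_sigma_tope h.1, mul_one]
    · simp
  · intro X hX Y _ hXY
    simp only [Finset.coe_filter, Finset.mem_filter, Finset.mem_univ, true_and,
      Set.mem_ofPred_eq] at hX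
    obtain ⟨x, hx⟩ := hX.1
    exact eq_of_mem_tope hx (hXY ▸ hx)

theorem signedOddEven_topes : A.signedOddEven A.topes =
    (-1) ^ n * feasibleSum (fun i => (A i).normal) (fun i => (A i).offset) := by
  classical
  have := sum_filter_topes (A := A) fun _ => True
  rw [Finset.filter_true] at this
  simp only [this, feasibleSum, feasible, and_true, tope]

/-! ### From simple arrangements to general position -/

/-- The linear map whose kernel is the direction of an intersection of hyperplanes. -/
noncomputable def normalMap (A : HyperplaneArrangement d n) (S : Finset (Fin n)) :
    EuclideanSpace ℝ (Fin d) →ₗ[ℝ] (S → ℝ) :=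
  LinearMap.pi fun i => (innerSL ℝ (A i).normal).toLinearMap

theorem normalMap_apply (S : Finset (Fin n)) (x : EuclideanSpace ℝ (Fin d)) (i : S) :
    A.normalMap S x i = inner ℝ (A i).normal x := rfl

theorem mem_inter {S : Finset (Fin n)} {x : EuclideanSpace ℝ (Fin d)} :
    x ∈ A.inter S ↔ ∀ i ∈ S, inner ℝ (A i).normal x = (A i).offset := by
  simp only [inter, AffineSubspace.mem_iInf_iff]
  exact Iff.rfl

theorem direction_inter {S : Finset (Fin n)}
    (h : (A.inter S : Set (EuclideanSpace ℝ (Fin d))).Nonempty) :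
    (A.inter S).direction = LinearMap.ker (A.normalMap S) := by
  obtain ⟨x, hx⟩ := h
  have hx' := mem_inter.mp hx
  ext v
  rw [← AffineSubspace.vadd_mem_iff_mem_direction v hx, mem_inter, LinearMap.mem_ker, funext_iff]
  simp only [normalMap_apply, Pi.zero_apply, Subtype.forall, vadd_eq_add, inner_add_right]
  refine forall₂_congr fun i hi => ?_
  rw [hx' i hi]
  simp

/-- By rank-nullity, codimension `W.card` makes `normalMap W` surjective; for `d` hyperplanes its
kernel is zero. -/
theorem IsSimple.inGeneralPosition (hA : A.IsSimple) :
    InGeneralPosition (fun i => (A i).normal) (fun i => (A i).offset) := by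
  have hf : finrank ℝ (EuclideanSpace ℝ (Fin d)) = d := by simp
  refine ⟨fun W hW y => ?_, fun W x hx => ?_, fun W hW v hv => ?_⟩
  · rw [hf] at hW
    obtain ⟨hne, hdim⟩ := hA.1 W hW
    rw [direction_inter hne] at hdim
    have hrn := LinearMap.finrank_range_add_finrank_ker (A.normalMap W)
    have hsurj : LinearMap.range (A.normalMap W) = ⊤ := by
      apply Submodule.eq_top_of_finrank_eq
      simp only [finrank_fintype_fun_eq_card, Fintype.card_coe]
      omega
    obtain ⟨w, hw⟩ := LinearMap.range_eq_top.mp hsurj fun i => y i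
    exact ⟨w, fun i hi => congrFun hw ⟨i, hi⟩⟩
  · by_contra hcon
    have h := hA.2 W (by omega)
    exact Set.eq_empty_iff_forall_notMem.mp h x (mem_inter.mpr hx)
  · rw [hf] at hW
    obtain ⟨S, hSW, hS⟩ := Finset.exists_subset_card_eq hW
    obtain ⟨hne, hdim⟩ := hA.1 S hS.le
    rw [direction_inter hne, hS, Nat.sub_self, Submodule.finrank_eq_zero] at hdim
    have : v ∈ LinearMap.ker (A.normalMap S) :=
      LinearMap.mem_ker.mpr (funext fun i => hv i (hSW i.2))
    simpa [hdim] using this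

/-! ### Boundedness and directions of recession -/

/-- A direction of recession makes a tope nonempty and unbounded. -/
theorem eventually_smul_mem_tope {X : Fin n → ℤˣ} {v : EuclideanSpace ℝ (Fin d)}
    (hv : v ∈ A.atInfinity.tope X) : ∀ᶠ t : ℝ in atTop, t • v ∈ A.tope X := by
  simp only [mem_tope, Filter.eventually_all]
  intro i
  have hi : 0 < ((X i : ℤ) : ℝ) * inner ℝ (A i).normal v := by
    simpa [atInfinity, OrientedHyperplane.translateToOrigin] using A.atInfinity.mem_tope.mp hv i
  have := (tendsto_id.atTop_mul_const hi).eventually_gt_atTop (((X i : ℤ) : ℝ) * (A i).offset)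
  filter_upwards [this] with t ht
  rw [inner_smul_right]
  simp only [id] at ht
  linarith

theorem not_isBounded_tope [Nonempty (Fin n)] {X : Fin n → ℤˣ}
    (h : (A.atInfinity.tope X).Nonempty) : ¬ Bornology.IsBounded (A.tope X) := by
  obtain ⟨v, hv⟩ := h
  -- With no hyperplanes, `v = 0` would be possible.
  have hv0 : v ≠ 0 := by
    rintro rfl
    have := A.atInfinity.mem_tope.mp hv (Classical.arbitrary _)
    simp [atInfinity, OrientedHyperplane.translateToOrigin] at this
  intro hb
  obtain ⟨C, hC⟩ := hb.exists_norm_le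
  have hlarge := (tendsto_id.atTop_mul_const (norm_pos_iff.mpr hv0)).eventually_gt_atTop C
  obtain ⟨t, ht, htC, ht0⟩ :=
    ((eventually_smul_mem_tope hv).and (hlarge.and (eventually_ge_atTop 0))).exists
  have := hC _ ht
  rw [norm_smul, Real.norm_of_nonneg ht0] at this
  simp only [id] at htC
  linarith

/-- A limit of the unit directions of points escaping to infinity; the limit preserves only weak
inequalities. -/
theorem exists_recession_of_not_isBounded {X : Fin n → ℤˣ}
    (h : ¬ Bornology.IsBounded (A.tope X)) :
    ∃ v : EuclideanSpace ℝ (Fin d), v ≠ 0 ∧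
      ∀ i, 0 ≤ ((X i : ℤ) : ℝ) * inner ℝ (A i).normal v := by
  have hx : ∀ k : ℕ, ∃ x ∈ A.tope X, (k : ℝ) + 1 < ‖x‖ := by
    intro k
    by_contra! hcon
    exact h (isBounded_iff_forall_norm_le.mpr ⟨_, hcon⟩)
  choose x hxT hxn using hx
  have hpos : ∀ k, 0 < ‖x k‖ := fun k => lt_trans (by positivity) (hxn k)
  have hS : ∀ k, ‖x k‖⁻¹ • x k ∈ Metric.sphere (0 : EuclideanSpace ℝ (Fin d)) 1 := fun k => by
    rw [mem_sphere_zero_iff_norm, norm_smul, norm_inv, norm_norm, inv_mul_cancel₀ (hpos k).ne']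
  obtain ⟨v, hvS, φ, hφ, hlim⟩ := (isCompact_sphere _ _).tendsto_subseq hS
  refine ⟨v, ?_, fun i => ?_⟩
  · rintro rfl
    simp at hvS
  have h1 : Tendsto (fun k => ((X i : ℤ) : ℝ) *
      inner ℝ (A i).normal (‖x (φ k)‖⁻¹ • x (φ k))) atTop
      (𝓝 (((X i : ℤ) : ℝ) * inner ℝ (A i).normal v)) :=
    (tendsto_const_nhds.inner hlim).const_mul _
  have hnorm : Tendsto (fun k => ‖x (φ k)‖) atTop atTop := by
    refine tendsto_atTop_mono (fun k => ?_) tendsto_natCast_atTop_atTop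
    have h2 : (k : ℝ) ≤ (φ k : ℝ) := by exact_mod_cast hφ.id_le k
    linarith [hxn (φ k)]
  have h2 : Tendsto (fun k => ‖x (φ k)‖⁻¹ * (((X i : ℤ) : ℝ) * (A i).offset)) atTop (𝓝 0) := by
    simpa using hnorm.inv_tendsto_atTop.mul_const (((X i : ℤ) : ℝ) * (A i).offset)
  refine le_of_tendsto_of_tendsto' h2 h1 fun k => ?_
  rw [inner_smul_right, mul_left_comm ((X i : ℤ) : ℝ)]
  refine mul_le_mul_of_nonneg_left ?_ (inv_nonneg.mpr (norm_nonneg _))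
  have := A.mem_tope.mp (hxT (φ k)) i
  linarith

/-- A nonzero weak direction of recession `v` is parallel to at most `d` hyperplanes, so by
simplicity some `w` points strictly to the required sides of these; then `v + ε • w` is strict for
small `ε`. -/
theorem IsSimple.isBounded_tope_iff [Nonempty (Fin n)] (hA : A.IsSimple) {X : Fin n → ℤˣ} :
    Bornology.IsBounded (A.tope X) ↔ ¬ (A.atInfinity.tope X).Nonempty := by
  refine ⟨fun hb h => not_isBounded_tope h hb, fun h => ?_⟩
  contrapose! h
  obtain ⟨v, hv0, hv⟩ := exists_recession_of_not_isBounded h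
  have hG := hA.inGeneralPosition
  set Z : Finset (Fin n) := Finset.univ.filter fun i => inner ℝ (A i).normal v = 0 with hZ
  have hZc : Z.card ≤ finrank ℝ (EuclideanSpace ℝ (Fin d)) := by
    by_contra hcon
    exact hv0 (hG.eq_zero Z (not_le.mp hcon).le v fun i hi => (Finset.mem_filter.mp hi).2)
  obtain ⟨w, hw⟩ := hG.exists_inner_eq Z hZc fun i => ((X i : ℤ) : ℝ)
  have hmem : v ∈ signCell (fun i => (A i).normal) 0 Zᶜ ∅ X := by
    refine ⟨by simp, fun i hi => ?_⟩
    have hi' : inner ℝ (A i).normal v ≠ 0 := by simpa [hZ] using hi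
    rw [Pi.zero_apply, sub_zero]
    exact lt_of_le_of_ne (hv i) (Ne.symm (mul_ne_zero (by simp) hi'))
  obtain ⟨ε, hε, hpos⟩ := ((eventually_add_smul_mem_signCell (w := w) hmem (by simp)).and
    self_mem_nhdsWithin).exists
  refine ⟨v + ε • w, A.atInfinity.mem_tope.mpr fun i => ?_⟩
  change 0 < ((X i : ℤ) : ℝ) * (inner ℝ (A i).normal (v + ε • w) - 0)
  by_cases hi : i ∈ Z
  · rw [sub_zero, inner_add_right, inner_smul_right, hw i hi, (Finset.mem_filter.mp hi).2,
      zero_add, mul_left_comm, signUnit_mul_self, mul_one]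
    exact hpos
  · exact hε.2 i (Finset.mem_compl.mpr hi)

/-- A sign vector realized at infinity is realized in `A`, so the indicator of a nonempty bounded
tope is the difference of the two feasibility indicators. -/
theorem IsSimple.signedOddEven_boundedTopes [Nonempty (Fin n)] (hA : A.IsSimple) :
    A.signedOddEven A.boundedTopes = A.signedOddEven A.topes -
      A.atInfinity.signedOddEven A.atInfinity.topes := by
  classical
  have h1 : A.signedOddEven A.boundedTopes = _ := sum_filter_topes _
  have h2 := sum_filter_topes (A := A) fun _ => True
  have h3 := sum_filter_topes (A := A.atInfinity) fun _ => True
  rw [Finset.filter_true] at h2 h3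
  rw [h1, h2, h3, ← mul_sub, ← Finset.sum_sub_distrib]
  congr 1
  refine Finset.sum_congr rfl fun X _ => ?_
  rw [← mul_sub, hA.isBounded_tope_iff]
  congr 1
  by_cases hinf : (A.atInfinity.tope X).Nonempty
  · have hne : (A.tope X).Nonempty := by
      obtain ⟨v, hv⟩ := hinf
      obtain ⟨t, ht⟩ := (eventually_smul_mem_tope hv).exists
      exact ⟨_, ht⟩
    simp [hinf, hne]
  · simp [hinf]

end HyperplaneArrangement

theorem theorem9 (d n : ℕ) (hd : Odd d) (A : HyperplaneArrangement d n) (hA : A.IsSimple) :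
    (Odd n →
      A.signedOddEven A.topes = 0 ∧
      A.atInfinity.signedOddEven A.atInfinity.topes = 0 ∧
      A.signedOddEven A.boundedTopes = 0) ∧
    (Even n → 0 < n →
      (A.signedOddEven A.boundedTopes : ℚ) =
        -(1 / 2) * (A.atInfinity.signedOddEven A.atInfinity.topes : ℚ)) := by
  have hinf : A.atInfinity.signedOddEven A.atInfinity.topes =
      (-1) ^ n * feasibleSum (fun i => (A i).normal) 0 :=
    HyperplaneArrangement.signedOddEven_topes
  have key : 0 < n →
      2 * A.signedOddEven A.topes = A.atInfinity.signedOddEven A.atInfinity.topes ∧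
      A.signedOddEven A.boundedTopes = A.signedOddEven A.topes -
        A.atInfinity.signedOddEven A.atInfinity.topes := fun hn => by
    have : Nonempty (Fin n) := ⟨⟨0, hn⟩⟩
    refine ⟨?_, hA.signedOddEven_boundedTopes⟩
    rw [hinf, HyperplaneArrangement.signedOddEven_topes,
      ← hA.inGeneralPosition.two_mul_feasibleSum (by simpa using hd)]
    ring
  refine ⟨fun hn => ?_, fun _ hn => ?_⟩
  · obtain ⟨h1, h2⟩ := key hn.pos
    rw [feasibleSum_zero_of_odd (by simpa using hn), mul_zero] at hinf
    exact ⟨by omega, hinf, by omega⟩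
  · obtain ⟨h1, h2⟩ := key hn
    rw [h2, ← h1]
    push_cast
    ring
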